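/- **Normal distribution model.** Fix $\sigma>0$ and an integer $T\ge 1$. For each $n$ let $p_n\in[0,1]$ and let $\mathbf u=\mathbf u^{(n)}=(u_1,\dots,u_n)\in\mathbb R^n$ be a deterministic score vector with $u_1=0$ and dynamic range $M_n=\max_{i,j}|u_i-u_j|$. For $1\le i<j\le n$ let the numbers of comparisons $n_{ij}$ be independent $\mathrm{Bin}(T,p_n)$ random variables and, given all the $n_{ij}$, let the outcomes $X_{ij}^{(t)}$, $1\le t\le n_{ij}$, be independent with $X_{ij}^{(t)}\sim N(u_i-u_j,\sigma^2)$. The models for all $n$ are defined on one probability space, with arbitrary joint dependence between different $n$. A maximum likelihood estimate (MLE) is a maximizer $\hat{\mathbf u}$ over $\{\mathbf v\in\mathbb R^n: v_1=0\}$ of $$l(\mathbf v)=\sum_{1\le i<j\le n}\ \sum_{t=1}^{n_{ij}}\log f(X_{ij}^{(t)};v_i-v_j),\qquad f(x;y)=\frac1{\sqrt{2\pi\sigma^2}}e^{-(x-y)^2/(2\sigma^2)} .$$ Assume that for some constant $c>1$ one has $p_n\ge c\,\frac{\log n}{n}$ for all sufficiently large $n$, and that, as $n\to\infty$, $$M_ne^{M_n}\frac{\log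 n}{\log (np_n)}\to 0\qquad\text{and}\qquad \Delta_n:=\sqrt{\frac{\log n}{np_n}}\;\frac{\log n}{\log (np_n)}\to 0 .$$ Then the MLE is uniformly consistent. Precisely, there is a constant $C>0$ depending only on $\sigma$ and $T$ such that for all sufficiently large $n$, with probability at least $1-14n^{-2}$, the MLE $\hat{\mathbf u}$ exists, is unique, and satisfies $\|\hat{\mathbf u}-\mathbf u\|_\infty\le C\Delta_n$. Consequently, almost surely the MLE exists and is unique for all but finitely many $n$, and $\|\hat{\mathbf u}-\mathbf u\|_\infty\to0$. -/

import Mathlib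

open MeasureTheory ProbabilityTheory Filter Topology
open scoped NNReal ENNReal

noncomputable section

/-- The unordered pairs of distinct subjects, listed as `i < j`; subject `i` of `[n]` is the
element `i - 1` of `Fin n`. -/
abbrev Pair (n : ℕ) : Type := {e : Fin n × Fin n // e.1 < e.2}

/-- The conditional log-likelihood given the comparison counts, for outcomes with density
`f x y` at relative score `y`: the outcomes `X e t` with `t < N e` are the observed ones. -/
def logLikelihood (f : ℝ → ℝ → ℝ) {n T : ℕ} (N : Pair n → ℕ) (X : Pair n → Fin T → ℝ)
    (v : Fin n → ℝ) : ℝ :=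
  ∑ e : Pair n, ∑ t ∈ Finset.univ.filter (fun t : Fin T => (t : ℕ) < N e),
    Real.log (f (X e t) (v e.1.1 - v e.1.2))

/-- The parameter space: score vectors whose first coordinate is zero. -/
def scoreSpace (n : ℕ) : Set (Fin n → ℝ) := {v | ∀ i : Fin n, (i : ℕ) = 0 → v i = 0}

/-- `v` is a maximum likelihood estimate: a maximizer of the log-likelihood over the
parameter space. -/
def IsMLE (f : ℝ → ℝ → ℝ) {n T : ℕ} (N : Pair n → ℕ) (X : Pair n → Fin T → ℝ)
    (v : Fin n → ℝ) : Prop :=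
  v ∈ scoreSpace n ∧ IsMaxOn (logLikelihood f N X) (scoreSpace n) v

/-- The density at `x` of the normal distribution with mean `y` and variance `σ ^ 2`. -/
def normalLink (σ : ℝ) (x y : ℝ) : ℝ := gaussianPDFReal y (σ ^ 2).toNNReal x

/-- The normal comparison model on `n` subjects with scores `u`: the counts `N e` are
independent `Bin(T, p)`; given the counts, the outcomes on the pair `(i, j)` are independent
normal variables with mean `u i - u j` and variance `σ ^ 2`, of which the first `N e` are
observed. -/
structure IsNormalComparison {Ω : Type*} [MeasurableSpace Ω] (P : Measure Ω) (σ : ℝ)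
    {n T : ℕ} (p : unitInterval) (u : Fin n → ℝ)
    (N : Pair n → Ω → ℕ) (X : Pair n → Fin T → Ω → ℝ) : Prop where
  count_law : ∀ e, HasLaw (N e) (binomial T p) P
  count_indep : iIndepFun N P
  outcome_law : ∀ e t,
    HasLaw (X e t) (gaussianReal (u e.1.1 - u e.1.2) (σ ^ 2).toNNReal) P
  outcome_indep : iIndepFun (fun et : Pair n × Fin T => X et.1 et.2) P
  count_outcome_indep :
    IndepFun (fun ω e => N e ω) (fun ω (et : Pair n × Fin T) => X et.1 et.2 ω) P

/-- The dynamic range `max_{i,j} |u i - u j|`. -/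
def dynamicRange {n : ℕ} (u : Fin n → ℝ) : ℝ := ⨆ ij : Fin n × Fin n, |u ij.1 - u ij.2|

/-- The rate `Δ_n = sqrt (log n / (n p)) * (log n / log (n p))`. -/
def rate (n : ℕ) (p : ℝ) : ℝ :=
  Real.sqrt (Real.log n / (n * p)) * (Real.log n / Real.log (n * p))

end

/-! The Gaussian log-likelihood is a constant minus a positive multiple of the sum of squared
residuals, so the MLE is a least squares estimate. Its normal equations say that the error `w = v -
u` solves a Laplace equation on the comparison graph, with weights the counts and right side the
noise at each subject (`IsMLE.laplaceEq`).

The deterministic core is `LaplaceEq.abs_sub_le`. Tested against the indicator of a level set `{w ≥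
s}`, the equation bounds the flux out of that set by `β` times its size. If the graph expands,
lowering the threshold by `h > β / γ` must therefore multiply the level set by more than `ρ` until
it holds over half of the subjects. This takes at most `K ≈ log n / log ρ` steps; upper and lower
level sets then meet, so `w` oscillates by at most `2 K h`.

Chernoff and union bounds give expansion with `γ = np/20`, `ρ = np/(8 log n)`
(`measure_not_expands_le`) and noise of order `√(np log n)` (`measure_exists_noise_ge_le`). Then `h`
is of order `√(log n / (np))`, and `rate → 0` forces `log ρ ≥ log (np) / 4`, so `K h` is of order
`rate`. Borel–Cantelli gives the almost sure statement. -/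

/-! ### Laplace equations on expanding weighted graphs. -/

/-- The pairs with one member in `A` and the other one outside `B`. -/
def boundaryPairs {n : ℕ} (A B : Finset (Fin n)) : Finset (Pair n) :=
  Finset.univ.filter fun e => (e.1.1 ∈ A ∧ e.1.2 ∉ B) ∨ (e.1.2 ∈ A ∧ e.1.1 ∉ B)

/-- The nonnegative weights `c` on pairs expand: every set `A` sends weight at least `γ * #A` out
of every superset `B` of size at most `n / 2` and at most `ρ * #A`. -/
def Expands {n : ℕ} (c : Pair n → ℝ) (γ ρ : ℝ) : Prop :=
  ∀ A B : Finset (Fin n), A.Nonempty → A ⊆ B → 2 * B.card ≤ n → (B.card : ℝ) ≤ ρ * A.card →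
    γ * A.card ≤ ∑ e ∈ boundaryPairs A B, c e

/-- The weak form of the Laplace equation `L w = b` for the weights `c`. -/
def LaplaceEq {n : ℕ} (c : Pair n → ℝ) (w b : Fin n → ℝ) : Prop :=
  ∀ d : Fin n → ℝ,
    ∑ e : Pair n, c e * (w e.1.1 - w e.1.2) * (d e.1.1 - d e.1.2) = ∑ i, b i * d i

theorem LaplaceEq.neg {n : ℕ} {c : Pair n → ℝ} {w b : Fin n → ℝ} (h : LaplaceEq c w b) :
    LaplaceEq c (-w) (-b) := by
  intro d
  have := h d
  simp only [Pi.neg_apply, neg_mul, Finset.sum_neg_distrib]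
  rw [← this, ← Finset.sum_neg_distrib]
  exact Finset.sum_congr rfl fun e _ => by ring

/-- If the larger level set were within the factor `ρ`, expansion would send weight `γ * #A` across
a drop of at least `h`, a flux exceeding the supply `β * #A`. -/
theorem LaplaceEq.card_lt_card_level {n : ℕ} {c : Pair n → ℝ} (hc : ∀ e, 0 ≤ c e)
    {γ ρ β h : ℝ} (hexp : Expands c γ ρ) {w b : Fin n → ℝ} (hw : LaplaceEq c w b)
    (hb : ∀ i, b i ≤ β) (hβ : β < h * γ) (hh : 0 ≤ h) (s : ℝ)
    (hA : (Finset.univ.filter fun j => s ≤ w j).Nonempty)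
    (hB : 2 * (Finset.univ.filter fun j => s - h ≤ w j).card ≤ n) :
    ρ * (Finset.univ.filter fun j => s ≤ w j).card <
      (Finset.univ.filter fun j => s - h ≤ w j).card := by
  set A := Finset.univ.filter fun j => s ≤ w j with hAdef
  set B := Finset.univ.filter fun j => s - h ≤ w j with hBdef
  by_contra! hcon
  have hAB : A ⊆ B := by
    intro j hj
    simp only [hAdef, hBdef, Finset.mem_filter, Finset.mem_univ, true_and] at hj ⊢
    linarith
  have h1 := hexp A B hA hAB hB hcon
  have h2 := hw fun i => if i ∈ A then 1 else 0
  have h3 : ∑ i, b i * (if i ∈ A then (1 : ℝ) else 0) ≤ β * A.card := by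
    simp only [mul_ite, mul_one, mul_zero, Finset.sum_ite_mem, Finset.univ_inter]
    calc ∑ i ∈ A, b i ≤ ∑ i ∈ A, β := Finset.sum_le_sum fun i _ => hb i
      _ = β * A.card := by rw [Finset.sum_const, nsmul_eq_mul, mul_comm]
  have h4 : h * ∑ e ∈ boundaryPairs A B, c e ≤
      ∑ e : Pair n, c e * (w e.1.1 - w e.1.2) *
        ((if e.1.1 ∈ A then (1 : ℝ) else 0) - (if e.1.2 ∈ A then 1 else 0)) := by
    rw [Finset.mul_sum, boundaryPairs, Finset.sum_filter]
    refine Finset.sum_le_sum fun e _ => ?_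
    have hce := hc e
    rw [mul_assoc]
    -- Every pair leaving `A` contributes nonnegatively, since `w` is larger on `A`; pairs that also
    -- leave `B` contribute at least `h`.
    have key : (if (e.1.1 ∈ A ∧ e.1.2 ∉ B) ∨ (e.1.2 ∈ A ∧ e.1.1 ∉ B) then h else 0) ≤
        (w e.1.1 - w e.1.2) *
        ((if e.1.1 ∈ A then (1 : ℝ) else 0) - (if e.1.2 ∈ A then 1 else 0)) := by
      simp only [hAdef, hBdef, Finset.mem_filter, Finset.mem_univ, true_and, not_le]
      split_ifs <;> grind
    have := mul_le_mul_of_nonneg_left key hce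
    refine le_trans (le_of_eq ?_) this
    split_ifs <;> ring
  have hApos : (0 : ℝ) < A.card := by exact_mod_cast hA.card_pos
  have h5 : h * (γ * A.card) ≤ h * ∑ e ∈ boundaryPairs A B, c e :=
    mul_le_mul_of_nonneg_left h1 hh
  nlinarith

/-- Starting from a level set containing `m`, each step of height `h` gains a factor `ρ` as long as
at most half of the vertices are reached; `K` such gains would already give all `n`. -/
theorem LaplaceEq.card_level_gt_half {n : ℕ} {c : Pair n → ℝ} (hc : ∀ e, 0 ≤ c e)
    {γ ρ β h : ℝ} (hexp : Expands c γ ρ) (hρ : 0 ≤ ρ) {w b : Fin n → ℝ} (hw : LaplaceEq c w b)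
    (hb : ∀ i, b i ≤ β) (hβ : β < h * γ) (hh : 0 ≤ h) {K : ℕ} (hK : (n : ℝ) ≤ ρ ^ K)
    (m : Fin n) :
    n < 2 * (Finset.univ.filter fun j => w m - K * h ≤ w j).card := by
  have hn : 0 < n := m.pos
  have grow : ∀ k : ℕ, n < 2 * (Finset.univ.filter fun j => w m - k * h ≤ w j).card ∨
      ρ ^ k ≤ (Finset.univ.filter fun j => w m - k * h ≤ w j).card := by
    intro k
    induction k with
    | zero =>
      right
      have : 0 < (Finset.univ.filter fun j => w m - (0 : ℕ) * h ≤ w j).card :=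
        Finset.card_pos.2 ⟨m, by simp⟩
      rw [pow_zero]
      exact_mod_cast this
    | succ k ih =>
      by_cases hB : n < 2 * (Finset.univ.filter fun j => w m - (k + 1 : ℕ) * h ≤ w j).card
      · exact Or.inl hB
      right
      push Not at hB
      have hs : w m - (k + 1 : ℕ) * h = w m - k * h - h := by push_cast; ring
      have hsub : (Finset.univ.filter fun j => w m - k * h ≤ w j) ⊆
          (Finset.univ.filter fun j => w m - (k + 1 : ℕ) * h ≤ w j) := by
        intro j hj
        simp only [Finset.mem_filter, Finset.mem_univ, true_and] at hj ⊢
        rw [hs]; linarith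
      have ih' := ih.resolve_left fun h' =>
        absurd (lt_of_lt_of_le h' (Nat.mul_le_mul_left 2 (Finset.card_le_card hsub))) (by omega)
      rw [hs] at hB ⊢
      have := hw.card_lt_card_level hc hexp hb hβ hh (w m - k * h)
        ⟨m, by simp; positivity⟩ hB
      rw [pow_succ']
      exact (mul_le_mul_of_nonneg_left ih' hρ).trans this.le
  rcases grow K with h1 | h1
  · exact h1
  · have : n ≤ (Finset.univ.filter fun j => w m - K * h ≤ w j).card := by
      exact_mod_cast hK.trans h1
    omega

/-- Solutions of a Laplace equation on an expanding weighted graph have small oscillation. -/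
theorem LaplaceEq.abs_sub_le {n : ℕ} {c : Pair n → ℝ} (hc : ∀ e, 0 ≤ c e)
    {γ ρ β h : ℝ} (hexp : Expands c γ ρ) (hρ : 0 ≤ ρ) {w b : Fin n → ℝ} (hw : LaplaceEq c w b)
    (hb : ∀ i, |b i| ≤ β) (hβ : β < h * γ) (hh : 0 ≤ h) {K : ℕ} (hK : (n : ℝ) ≤ ρ ^ K)
    (i j : Fin n) : |w i - w j| ≤ 2 * K * h := by
  suffices H : ∀ i j, w i - w j ≤ 2 * K * h from abs_sub_le_iff.2 ⟨H i j, H j i⟩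
  intro i j
  have h1 := hw.card_level_gt_half hc hexp hρ (fun i => (abs_le.1 (hb i)).2) hβ hh hK i
  have h2 := hw.neg.card_level_gt_half hc hexp hρ
    (fun i => by have := (abs_le.1 (hb i)).1; simp only [Pi.neg_apply]; linarith) hβ hh hK j
  -- Each set has more than `n / 2` elements; a common vertex links `w i` to `w j` at cost `K * h`
  -- on either side.
  have h3 : ¬ Disjoint (Finset.univ.filter fun k => w i - K * h ≤ w k)
      (Finset.univ.filter fun k => (-w) j - K * h ≤ (-w) k) := by
    intro hd
    have := Finset.card_union_of_disjoint hd
    have h4 := Finset.card_le_univ ((Finset.univ.filter fun k => w i - K * h ≤ w k) ∪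
      (Finset.univ.filter fun k => (-w) j - K * h ≤ (-w) k))
    rw [Fintype.card_fin] at h4
    omega
  obtain ⟨k, hk1, hk2⟩ := Finset.not_disjoint_iff.1 h3
  simp only [Finset.mem_filter, Finset.mem_univ, true_and, Pi.neg_apply] at hk1 hk2
  linarith

/-! ### Least squares: existence, normal equations, uniqueness. -/

/-- The indices of the observed outcomes of the pair `e`. -/
def observed {n : ℕ} (T : ℕ) (N : Pair n → ℕ) (e : Pair n) : Finset (Fin T) :=
  Finset.univ.filter fun t : Fin T => (t : ℕ) < N e

/-- The sum of squared residuals of the score vector `v`. -/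
def sqLoss {n T : ℕ} (N : Pair n → ℕ) (X : Pair n → Fin T → ℝ) (v : Fin n → ℝ) : ℝ :=
  ∑ e : Pair n, ∑ t ∈ observed T N e, (X e t - (v e.1.1 - v e.1.2)) ^ 2

/-- The signed incidence `1_{e.1 = i} - 1_{e.2 = i}`. -/
def incidence {n : ℕ} (i : Fin n) (e : Pair n) : ℝ :=
  (if e.1.1 = i then 1 else 0) - (if e.1.2 = i then 1 else 0)

/-- The total signed deviation of the observed outcomes of subject `i` from their means. -/
def noise {n T : ℕ} (u : Fin n → ℝ) (N : Pair n → ℕ) (X : Pair n → Fin T → ℝ) (i : Fin n) : ℝ :=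
  ∑ e : Pair n, ∑ t ∈ observed T N e, (X e t - (u e.1.1 - u e.1.2)) * incidence i e

theorem sum_incidence_mul {n : ℕ} (d : Fin n → ℝ) (e : Pair n) :
    ∑ i, incidence i e * d i = d e.1.1 - d e.1.2 := by
  simp [incidence, sub_mul, Finset.sum_sub_distrib]

theorem log_normalLink {σ : ℝ} (hσ : 0 < σ) (x y : ℝ) :
    Real.log (normalLink σ x y) =
      Real.log (√(2 * Real.pi * σ ^ 2))⁻¹ - (2 * σ ^ 2)⁻¹ * (x - y) ^ 2 := by
  have h : 0 < 2 * Real.pi * σ ^ 2 := by positivity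
  rw [normalLink, gaussianPDFReal, Real.coe_toNNReal _ (sq_nonneg σ),
    Real.log_mul (by positivity) (Real.exp_ne_zero _), Real.log_exp]
  ring

theorem logLikelihood_normalLink {σ : ℝ} (hσ : 0 < σ) {n T : ℕ} (N : Pair n → ℕ)
    (X : Pair n → Fin T → ℝ) (v : Fin n → ℝ) :
    logLikelihood (normalLink σ) N X v =
      (∑ e : Pair n, ∑ _t ∈ observed T N e, Real.log (√(2 * Real.pi * σ ^ 2))⁻¹) -
        (2 * σ ^ 2)⁻¹ * sqLoss N X v := by
  simp only [logLikelihood, sqLoss, log_normalLink hσ, Finset.mul_sum, Finset.sum_sub_distrib,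
    observed]

theorem isMLE_normalLink_iff {σ : ℝ} (hσ : 0 < σ) {n T : ℕ} {N : Pair n → ℕ}
    {X : Pair n → Fin T → ℝ} {v : Fin n → ℝ} :
    IsMLE (normalLink σ) N X v ↔
      v ∈ scoreSpace n ∧ ∀ v' ∈ scoreSpace n, sqLoss N X v ≤ sqLoss N X v' := by
  have h : 0 < (2 * σ ^ 2)⁻¹ := by positivity
  refine and_congr_right fun _ => forall₂_congr fun v' _ => ?_
  simp only [Set.mem_ofPred_eq, logLikelihood_normalLink hσ]
  rw [sub_le_sub_iff_left, mul_le_mul_iff_right₀ h]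

/-- The linear map sending scores to the differences of the observed pairs. -/
def designMap {n : ℕ} (T : ℕ) (N : Pair n → ℕ) :
    (Fin n → ℝ) →ₗ[ℝ] EuclideanSpace ℝ (Pair n × Fin T) where
  toFun v := WithLp.toLp 2 fun et => if (et.2 : ℕ) < N et.1 then v et.1.1.1 - v et.1.1.2 else 0
  map_add' v w := by
    ext et
    simp only [PiLp.add_apply, Pi.add_apply]
    split_ifs <;> ring
  map_smul' a v := by
    ext et
    simp only [PiLp.smul_apply, Pi.smul_apply, smul_eq_mul, RingHom.id_apply]
    split_ifs <;> ring

/-- The parameter space as a linear subspace. -/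
def scoreSubmodule (n : ℕ) : Submodule ℝ (Fin n → ℝ) where
  carrier := scoreSpace n
  zero_mem' := fun _ _ => rfl
  add_mem' := fun {v w} hv hw i hi => by simp [hv i hi, hw i hi]
  smul_mem' := fun a v hv i hi => by simp [hv i hi]

theorem sqLoss_eq_norm_sq {n T : ℕ} (N : Pair n → ℕ) (X : Pair n → Fin T → ℝ) (v : Fin n → ℝ) :
    sqLoss N X v = ‖WithLp.toLp 2 (fun et : Pair n × Fin T =>
      if (et.2 : ℕ) < N et.1 then X et.1 et.2 else 0) - designMap T N v‖ ^ 2 := by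
  rw [EuclideanSpace.real_norm_sq_eq, Fintype.sum_prod_type, sqLoss]
  refine Finset.sum_congr rfl fun e _ => ?_
  rw [observed, Finset.sum_filter]
  refine Finset.sum_congr rfl fun t _ => ?_
  simp only [designMap, LinearMap.coe_mk, AddHom.coe_mk, PiLp.sub_apply]
  split_ifs <;> simp

/-- Orthogonal projection of the observed data onto the image of the parameter space. No
connectivity of the graph is needed; that enters only for uniqueness. -/
theorem exists_isMLE_normalLink {σ : ℝ} (hσ : 0 < σ) {n T : ℕ} (N : Pair n → ℕ)
    (X : Pair n → Fin T → ℝ) : ∃ v, IsMLE (normalLink σ) N X v := by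
  set x : EuclideanSpace ℝ (Pair n × Fin T) := WithLp.toLp 2 (fun et : Pair n × Fin T =>
      if (et.2 : ℕ) < N et.1 then X et.1 et.2 else 0) with hx
  set S := (scoreSubmodule n).map (designMap T N)
  obtain ⟨y, hyS, hy⟩ := S.exists_norm_eq_iInf_of_complete_subspace
    (Submodule.complete_of_finiteDimensional S) x
  obtain ⟨v, hv, rfl⟩ := Submodule.mem_map.1 hyS
  refine ⟨v, (isMLE_normalLink_iff hσ).2 ⟨hv, fun v' hv' => ?_⟩⟩
  rw [sqLoss_eq_norm_sq, sqLoss_eq_norm_sq, ← hx, hy]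
  have hle : (⨅ w : S, ‖x - w‖) ≤ ‖x - designMap T N v'‖ :=
    ciInf_le (f := fun w : S => ‖x - w‖) ⟨0, by rintro _ ⟨w, rfl⟩; exact norm_nonneg _⟩
      ⟨designMap T N v', Submodule.mem_map_of_mem hv'⟩
  exact pow_le_pow_left₀ (hy ▸ norm_nonneg _) hle 2

theorem sqLoss_add_smul {n T : ℕ} (N : Pair n → ℕ) (X : Pair n → Fin T → ℝ) (v d : Fin n → ℝ)
    (s : ℝ) :
    sqLoss N X (v + s • d) = sqLoss N X v +
      ((∑ e : Pair n, ∑ _t ∈ observed T N e, (d e.1.1 - d e.1.2) ^ 2) * (s * s) +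
      (-2 * ∑ e : Pair n, ∑ t ∈ observed T N e,
        (X e t - (v e.1.1 - v e.1.2)) * (d e.1.1 - d e.1.2)) * s) := by
  simp only [sqLoss, Finset.mul_sum, Finset.sum_mul, ← Finset.sum_add_distrib]
  refine Finset.sum_congr rfl fun e _ => Finset.sum_congr rfl fun t _ => ?_
  simp only [Pi.add_apply, Pi.smul_apply, smul_eq_mul]
  ring

theorem sum_residual_eq_zero {σ : ℝ} (hσ : 0 < σ) {n T : ℕ} {N : Pair n → ℕ}
    {X : Pair n → Fin T → ℝ} {v : Fin n → ℝ} (hv : IsMLE (normalLink σ) N X v)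
    (d : Fin n → ℝ) :
    ∑ e : Pair n, ∑ t ∈ observed T N e,
      (X e t - (v e.1.1 - v e.1.2)) * (d e.1.1 - d e.1.2) = 0 := by
  rcases Nat.eq_zero_or_pos n with rfl | hn
  · exact Finset.sum_eq_zero fun e _ => e.1.1.elim0
  obtain ⟨hv0, hmin⟩ := (isMLE_normalLink_iff hσ).1 hv
  -- Only differences of `d` matter, so subtracting a constant makes an arbitrary direction
  -- admissible.
  set d' : Fin n → ℝ := fun i => d i - d ⟨0, hn⟩ with hd'
  have hmem : ∀ s : ℝ, v + s • d' ∈ scoreSpace n := by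
    intro s
    refine (scoreSubmodule n).add_mem hv0 ((scoreSubmodule n).smul_mem s fun i hi => ?_)
    have : i = ⟨0, hn⟩ := Fin.ext hi
    simp [hd', this]
  have hq : ∀ s : ℝ, 0 ≤ (∑ e : Pair n, ∑ _t ∈ observed T N e, (d' e.1.1 - d' e.1.2) ^ 2) *
      (s * s) + (-2 * ∑ e : Pair n, ∑ t ∈ observed T N e,
        (X e t - (v e.1.1 - v e.1.2)) * (d' e.1.1 - d' e.1.2)) * s + 0 := by
    intro s
    have := hmin _ (hmem s)
    rw [sqLoss_add_smul] at this
    linarith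
  -- The constant term is zero, so the discriminant is the square of the linear coefficient, which
  -- must vanish.
  have hdisc := discrim_le_zero hq
  simp only [discrim, hd', sub_sub_sub_cancel_right] at hdisc
  nlinarith

theorem IsMLE.laplaceEq {σ : ℝ} (hσ : 0 < σ) {n T : ℕ} {N : Pair n → ℕ}
    {X : Pair n → Fin T → ℝ} {v : Fin n → ℝ} (hv : IsMLE (normalLink σ) N X v)
    (u : Fin n → ℝ) :
    LaplaceEq (fun e => ((observed T N e).card : ℝ)) (v - u) (noise u N X) := by
  intro d
  have h := sum_residual_eq_zero hσ hv d
  have h2 : ∑ i, noise u N X i * d i =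
      ∑ e : Pair n, ∑ t ∈ observed T N e,
        (X e t - (u e.1.1 - u e.1.2)) * (d e.1.1 - d e.1.2) := by
    simp only [noise, Finset.sum_mul]
    rw [Finset.sum_comm]
    refine Finset.sum_congr rfl fun e _ => ?_
    rw [Finset.sum_comm]
    refine Finset.sum_congr rfl fun t _ => ?_
    simp only [mul_assoc]
    rw [← Finset.mul_sum, sum_incidence_mul]
  rw [h2, ← sub_eq_zero, ← neg_eq_zero, ← h, ← Finset.sum_sub_distrib, ← Finset.sum_neg_distrib]
  refine Finset.sum_congr rfl fun e _ => ?_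
  have : ((observed T N e).card : ℝ) * ((v - u) e.1.1 - (v - u) e.1.2) * (d e.1.1 - d e.1.2) =
      ∑ _t ∈ observed T N e, ((v - u) e.1.1 - (v - u) e.1.2) * (d e.1.1 - d e.1.2) := by
    rw [Finset.sum_const, nsmul_eq_mul, mul_assoc]
  rw [this, ← Finset.sum_sub_distrib, ← Finset.sum_neg_distrib]
  refine Finset.sum_congr rfl fun t _ => ?_
  simp only [Pi.sub_apply]
  ring

theorem norm_le_of_abs_sub_le {n : ℕ} {w : Fin n → ℝ} (hw : w ∈ scoreSpace n) {r : ℝ}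
    (hr : 0 ≤ r) (h : ∀ i j, |w i - w j| ≤ r) : ‖w‖ ≤ r := by
  refine (pi_norm_le_iff_of_nonneg hr).2 fun i => ?_
  have := h i ⟨0, i.pos⟩
  rwa [hw ⟨0, i.pos⟩ rfl, sub_zero] at this

theorem IsMLE.norm_sub_le {σ : ℝ} (hσ : 0 < σ) {n T : ℕ} {N : Pair n → ℕ}
    {X : Pair n → Fin T → ℝ} {γ ρ β h : ℝ}
    (hexp : Expands (fun e => ((observed T N e).card : ℝ)) γ ρ) (hρ : 0 ≤ ρ)
    {u v : Fin n → ℝ} (hu : u ∈ scoreSpace n) (hv : IsMLE (normalLink σ) N X v)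
    (hb : ∀ i, |noise u N X i| ≤ β) (hβ : β < h * γ) (hh : 0 ≤ h) {K : ℕ}
    (hK : (n : ℝ) ≤ ρ ^ K) : ‖v - u‖ ≤ 2 * K * h :=
  norm_le_of_abs_sub_le ((scoreSubmodule n).sub_mem hv.1 hu) (by positivity)
    ((hv.laplaceEq hσ u).abs_sub_le (fun _ => Nat.cast_nonneg _) hexp hρ hb hβ hh hK)

/-- The difference of two estimates solves the Laplace equation with right side zero, so the
oscillation bound holds for every `h > 0`. -/
theorem existsUnique_isMLE {σ : ℝ} (hσ : 0 < σ) {n T : ℕ} {N : Pair n → ℕ}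
    {X : Pair n → Fin T → ℝ} {γ ρ : ℝ} (hγ : 0 < γ)
    (hexp : Expands (fun e => ((observed T N e).card : ℝ)) γ ρ) (hρ : 0 ≤ ρ) {K : ℕ}
    (hK : (n : ℝ) ≤ ρ ^ K) : ∃! v, IsMLE (normalLink σ) N X v := by
  obtain ⟨v, hv⟩ := exists_isMLE_normalLink hσ N X
  refine ⟨v, hv, fun v' hv' => ?_⟩
  have hlap : LaplaceEq (fun e => ((observed T N e).card : ℝ)) (v' - v) 0 := by
    intro d
    have h1 := hv'.laplaceEq hσ 0 d
    have h2 := hv.laplaceEq hσ 0 d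
    simp only [Pi.zero_apply, zero_mul, Finset.sum_const_zero]
    rw [← sub_self (∑ i, noise 0 N X i * d i)]
    nth_rewrite 1 [← h1]
    rw [← h2, ← Finset.sum_sub_distrib]
    refine Finset.sum_congr rfl fun e _ => ?_
    simp only [Pi.sub_apply, Pi.zero_apply]
    ring
  have hle : ∀ h : ℝ, 0 < h → ‖v' - v‖ ≤ 2 * K * h := fun h hh =>
    norm_le_of_abs_sub_le ((scoreSubmodule n).sub_mem hv'.1 hv.1) (by positivity)
      (hlap.abs_sub_le (fun _ => Nat.cast_nonneg _) hexp hρ (β := 0) (by simp)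
        (by positivity) hh.le hK)
  rw [← sub_eq_zero, ← norm_le_zero_iff]
  refine le_of_forall_pos_le_add fun ε hε => ?_
  have := hle (ε / (2 * K + 1)) (by positivity)
  refine this.trans ?_
  rw [zero_add, ← mul_div_assoc, div_le_iff₀ (by positivity)]
  nlinarith

/-! ### Exponential moments and Chernoff bounds. -/

theorem lintegral_pi_prod {ι : Type*} [Fintype ι] {α : ι → Type*} [∀ i, MeasurableSpace (α i)]
    (μ : ∀ i, Measure (α i)) [∀ i, IsProbabilityMeasure (μ i)] {f : ∀ i, α i → ℝ≥0∞}
    (hf : ∀ i, Measurable (f i)) :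
    ∫⁻ x, ∏ i, f i (x i) ∂Measure.pi μ = ∏ i, ∫⁻ x, f i x ∂μ i := by
  rw [lintegral_prod_eq_prod_lintegral_of_indepFun (μ := Measure.pi μ) Finset.univ
    (fun i (x : ∀ i, α i) => f i (x i)) (iIndepFun_pi fun i => (hf i).aemeasurable)
    fun i => (hf i).comp (measurable_pi_apply i)]
  exact Finset.prod_congr rfl fun i _ =>
    (measurePreserving_eval μ i).lintegral_comp (hf i)

theorem ofReal_exp_sum {ι : Type*} (s : Finset ι) (f : ι → ℝ) :
    ENNReal.ofReal (Real.exp (∑ i ∈ s, f i)) = ∏ i ∈ s, ENNReal.ofReal (Real.exp (f i)) := by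
  rw [Real.exp_sum, ENNReal.ofReal_prod_of_nonneg fun i _ => (Real.exp_pos _).le]

theorem lintegral_exp_binomial_le (T : ℕ) (p : unitInterval) (s : ℝ) :
    ∫⁻ k, ENNReal.ofReal (Real.exp (s * (k : ℝ))) ∂binomial T p ≤
      ENNReal.ofReal (Real.exp (T * p * (Real.exp s - 1))) := by
  have hp0 : (0 : ℝ) ≤ p := p.2.1
  have hp1 : (p : ℝ) ≤ 1 := p.2.2
  have h1 : ∫⁻ k, ENNReal.ofReal (Real.exp (s * (k : ℝ))) ∂binomial T p =
      ENNReal.ofReal ((p * Real.exp s + (1 - p)) ^ T) := by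
    rw [binomial_eq_sum_dirac, lintegral_finsetSum_measure, add_pow,
      ENNReal.ofReal_sum_of_nonneg]
    · refine Finset.sum_congr (by ext; simp) fun k _ => ?_
      rw [lintegral_smul_measure, lintegral_dirac, smul_eq_mul,
        ← ENNReal.ofReal_mul binomial_nonneg, mul_comm s, Real.exp_nat_mul]
      congr 1
      ring
    · intro k _
      have : (0 : ℝ) ≤ 1 - p := by linarith
      positivity
  rw [h1]
  refine ENNReal.ofReal_le_ofReal ?_
  rw [mul_assoc, Real.exp_nat_mul]
  refine pow_le_pow_left₀ (by have := Real.exp_pos s; nlinarith [mul_nonneg hp0 this.le]) ?_ T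
  have := Real.add_one_le_exp ((p : ℝ) * (Real.exp s - 1))
  linarith

theorem lintegral_exp_gaussian (m : ℝ) (v : ℝ≥0) (a : ℝ) :
    ∫⁻ x, ENNReal.ofReal (Real.exp (a * (x - m))) ∂gaussianReal m v =
      ENNReal.ofReal (Real.exp (v * a ^ 2 / 2)) := by
  have hint : Integrable (fun x => Real.exp (a * (x - m))) (gaussianReal m v) := by
    have := (integrable_exp_mul_gaussianReal (μ := m) (v := v) a).mul_const (Real.exp (-(a * m)))
    refine this.congr (ae_of_all _ fun x => ?_)
    simp only [← Real.exp_add]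
    ring_nf
  rw [← ofReal_integral_eq_lintegral_ofReal hint (ae_of_all _ fun _ => (Real.exp_pos _).le)]
  have h2 := congrFun (mgf_fun_id_gaussianReal (μ := m) (v := v)) a
  rw [mgf] at h2
  have h3 : ∀ x, Real.exp (a * (x - m)) = Real.exp (a * x) * Real.exp (-(a * m)) := fun x => by
    rw [← Real.exp_add]; ring_nf
  simp_rw [h3]
  rw [integral_mul_const, h2, ← Real.exp_add]
  ring_nf

theorem lintegral_exp_pi_binomial_le {n T : ℕ} (p : unitInterval) (s : Pair n → ℝ) :
    ∫⁻ k, ENNReal.ofReal (Real.exp (∑ e, s e * (k e : ℝ)))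
        ∂Measure.pi (fun _ : Pair n => binomial T p) ≤
      ENNReal.ofReal (Real.exp (∑ e, T * p * (Real.exp (s e) - 1))) := by
  simp_rw [ofReal_exp_sum]
  rw [lintegral_pi_prod _ (f := fun e (k : ℕ) => ENNReal.ofReal (Real.exp (s e * (k : ℝ))))
    fun e => .of_discrete]
  exact Finset.prod_le_prod' fun e _ => lintegral_exp_binomial_le T p (s e)

theorem lintegral_exp_pi_gaussian {ι : Type*} [Fintype ι] (m : ι → ℝ) (v : ℝ≥0) (a : ι → ℝ) :
    ∫⁻ x, ENNReal.ofReal (Real.exp (∑ i, a i * (x i - m i)))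
        ∂Measure.pi (fun i => gaussianReal (m i) v) =
      ENNReal.ofReal (Real.exp (∑ i, v * a i ^ 2 / 2)) := by
  simp_rw [ofReal_exp_sum]
  rw [lintegral_pi_prod _ (f := fun i x => ENNReal.ofReal (Real.exp (a i * (x - m i))))
    fun i => by fun_prop]
  exact Finset.prod_congr rfl fun i _ => lintegral_exp_gaussian _ _ _

theorem card_observed_le {n : ℕ} (T : ℕ) (N : Pair n → ℕ) (e : Pair n) :
    (observed T N e).card ≤ N e := by
  rw [← Finset.card_range (N e)]
  exact Finset.card_le_card_of_injOn (fun t => (t : ℕ))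
    (fun t ht => by simpa [observed] using ht) (Fin.val_injective.injOn)

theorem card_observed {n T : ℕ} {N : Pair n → ℕ} {e : Pair n} (h : N e ≤ T) :
    (observed T N e).card = N e := by
  refine le_antisymm (card_observed_le T N e) ?_
  conv_lhs => rw [← Finset.card_range (N e)]
  refine Finset.card_le_card_of_surjOn (fun t : Fin T => (t : ℕ)) fun k hk => ?_
  have hk' : k < N e := by simpa using hk
  exact ⟨⟨k, hk'.trans_le h⟩, by simpa [observed] using hk', rfl⟩

theorem noise_eq_sum {n T : ℕ} (u : Fin n → ℝ) (N : Pair n → ℕ) (X : Pair n → Fin T → ℝ)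
    (i : Fin n) (l : ℝ) :
    l * noise u N X i = ∑ et : Pair n × Fin T,
      (if (et.2 : ℕ) < N et.1 then l * incidence i et.1 else 0) *
        (X et.1 et.2 - (u et.1.1.1 - u et.1.1.2)) := by
  rw [Fintype.sum_prod_type, noise, Finset.mul_sum]
  refine Finset.sum_congr rfl fun e _ => ?_
  rw [observed, Finset.sum_filter, Finset.mul_sum]
  refine Finset.sum_congr rfl fun t _ => ?_
  dsimp only
  split_ifs <;> ring

theorem sum_incidence_sq_le {n : ℕ} (i : Fin n) : ∑ e : Pair n, incidence i e ^ 2 ≤ n := by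
  have h1 : ∀ e : Pair n, incidence i e ^ 2 ≤ if e.1.1 = i ∨ e.1.2 = i then 1 else 0 := by
    intro e
    have := e.2.ne
    unfold incidence
    split_ifs <;> simp_all
  refine (Finset.sum_le_sum fun e _ => h1 e).trans ?_
  rw [Finset.sum_boole]
  have : (Finset.univ.filter fun e : Pair n => e.1.1 = i ∨ e.1.2 = i).card ≤
      (Finset.univ : Finset (Fin n)).card := by
    -- A pair containing `i` is determined by its other member.
    refine Finset.card_le_card_of_injOn (fun e => if e.1.1 = i then e.1.2 else e.1.1)
      (fun _ _ => Finset.mem_coe.2 (Finset.mem_univ _)) ?_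
    rintro ⟨⟨a, b⟩, hab⟩ h ⟨⟨a', b'⟩, hab'⟩ h' heq
    simp only [Finset.coe_filter, Finset.mem_univ, true_and, Set.mem_ofPred_eq] at h h' heq hab hab'
    simp only [Subtype.mk.injEq, Prod.mk.injEq]
    grind
  rw [Finset.card_univ, Fintype.card_fin] at this
  exact_mod_cast this

theorem exp_mul_incidence_sq_sub_one {n : ℕ} (i : Fin n) (e : Pair n) (s : ℝ) :
    Real.exp (s * incidence i e ^ 2) - 1 = (Real.exp s - 1) * incidence i e ^ 2 := by
  unfold incidence
  split_ifs <;> simp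

section Model

variable {Ω : Type*} [MeasurableSpace Ω] {P : Measure Ω} {σ : ℝ}
  {n T : ℕ} {p : unitInterval} {u : Fin n → ℝ} {N : Pair n → Ω → ℕ} {X : Pair n → Fin T → Ω → ℝ}

theorem IsNormalComparison.hasLaw_count (h : IsNormalComparison P σ p u N X) :
    HasLaw (fun ω e => N e ω) (Measure.pi fun _ : Pair n => binomial T p) P :=
  h.count_indep.hasLaw_pi h.count_law

theorem IsNormalComparison.hasLaw_prod [IsProbabilityMeasure P]
    (h : IsNormalComparison P σ p u N X) :
    HasLaw (fun ω => ((fun e => N e ω), fun et : Pair n × Fin T => X et.1 et.2 ω))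
      ((Measure.pi fun _ : Pair n => binomial T p).prod
        (Measure.pi fun et : Pair n × Fin T =>
          gaussianReal (u et.1.1.1 - u et.1.1.2) (σ ^ 2).toNNReal)) P :=
  h.count_outcome_indep.hasLaw_prod h.hasLaw_count
    (h.outcome_indep.hasLaw_pi fun et => h.outcome_law et.1 et.2)

theorem measurable_noise (u : Fin n → ℝ) (i : Fin n) :
    Measurable fun z : (Pair n → ℕ) × (Pair n × Fin T → ℝ) =>
      noise u z.1 (fun e t => z.2 (e, t)) i := by
  have h : ∀ z : (Pair n → ℕ) × (Pair n × Fin T → ℝ),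
      noise u z.1 (fun e t => z.2 (e, t)) i = ∑ et : Pair n × Fin T,
      (if (et.2 : ℕ) < z.1 et.1 then 1 * incidence i et.1 else 0) *
        (z.2 et - (u et.1.1.1 - u et.1.1.2)) := fun z => by
    rw [← noise_eq_sum u z.1 (fun e t => z.2 (e, t)) i 1, one_mul]
  simp_rw [h]
  refine Finset.measurable_sum _ fun et _ => Measurable.mul ?_ (by fun_prop)
  refine Measurable.ite ?_ measurable_const measurable_const
  exact measurableSet_lt measurable_const (by fun_prop)

/-- Given the counts, the noise at `i` is a centred Gaussian with variance `σ ^ 2` times the number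
of observed comparisons of `i`. Integrating over the counts then uses the binomial moment bound,
where `incidence i e ^ 2` is `0` or `1`. -/
theorem IsNormalComparison.lintegral_exp_noise_le [IsProbabilityMeasure P]
    (h : IsNormalComparison P σ p u N X)
    (i : Fin n) (l : ℝ) :
    ∫⁻ ω, ENNReal.ofReal (Real.exp (l * noise u (fun e => N e ω) (fun e t => X e t ω) i)) ∂P ≤
      ENNReal.ofReal (Real.exp (T * p * (Real.exp (σ ^ 2 * l ^ 2 / 2) - 1) * n)) := by
  have hmeas : Measurable fun z : (Pair n → ℕ) × (Pair n × Fin T → ℝ) =>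
      ENNReal.ofReal (Real.exp (l * noise u z.1 (fun e t => z.2 (e, t)) i)) :=
    ENNReal.measurable_ofReal.comp (Real.measurable_exp.comp
      ((measurable_noise u i).const_mul l))
  have e1 := h.hasLaw_prod.lintegral_comp hmeas.aemeasurable
  rw [e1, lintegral_prod _ hmeas.aemeasurable]
  have hinner : ∀ k : Pair n → ℕ,
      ∫⁻ x, ENNReal.ofReal (Real.exp (l * noise u k (fun e (t : Fin T) => x (e, t)) i))
        ∂(Measure.pi fun et : Pair n × Fin T =>
          gaussianReal (u et.1.1.1 - u et.1.1.2) (σ ^ 2).toNNReal) ≤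
      ENNReal.ofReal (Real.exp (∑ e, σ ^ 2 * l ^ 2 / 2 * incidence i e ^ 2 * (k e : ℝ))) := by
    intro k
    simp_rw [noise_eq_sum]
    rw [lintegral_exp_pi_gaussian (fun et : Pair n × Fin T => u et.1.1.1 - u et.1.1.2)
      _ (fun et => if (et.2 : ℕ) < k et.1 then l * incidence i et.1 else 0)]
    refine ENNReal.ofReal_le_ofReal (Real.exp_le_exp.2 ?_)
    rw [Fintype.sum_prod_type]
    refine Finset.sum_le_sum fun e _ => ?_
    have h1 : ∀ t : Fin T, ((σ ^ 2).toNNReal : ℝ) *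
        (if (t : ℕ) < k e then l * incidence i e else 0) ^ 2 / 2 =
        if (t : ℕ) < k e then σ ^ 2 * l ^ 2 / 2 * incidence i e ^ 2 else 0 := by
      intro t
      rw [Real.coe_toNNReal _ (sq_nonneg σ)]
      split_ifs <;> ring
    simp_rw [h1]
    rw [← Finset.sum_filter, Finset.sum_const, nsmul_eq_mul, mul_comm]
    exact mul_le_mul_of_nonneg_left (Nat.cast_le.2 (card_observed_le T k e)) (by positivity)
  refine (lintegral_mono hinner).trans ((lintegral_exp_pi_binomial_le p _).trans ?_)
  refine ENNReal.ofReal_le_ofReal (Real.exp_le_exp.2 ?_)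
  simp_rw [exp_mul_incidence_sq_sub_one, ← mul_assoc]
  rw [← Finset.mul_sum]
  have hp0 : (0 : ℝ) ≤ p := p.2.1
  have : 0 ≤ Real.exp (σ ^ 2 * l ^ 2 / 2) - 1 := by
    linarith [Real.one_le_exp (show 0 ≤ σ ^ 2 * l ^ 2 / 2 by positivity)]
  exact mul_le_mul_of_nonneg_left (sum_incidence_sq_le i) (by positivity)

theorem measure_le_of_lintegral_exp_le {f : Ω → ℝ} (hf : AEMeasurable f P) {a : ℝ}
    (h : ∫⁻ ω, ENNReal.ofReal (Real.exp (f ω)) ∂P ≤ ENNReal.ofReal (Real.exp a)) (y : ℝ) :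
    P {ω | y ≤ f ω} ≤ ENNReal.ofReal (Real.exp (a - y)) := by
  have hm : AEMeasurable (fun ω => ENNReal.ofReal (Real.exp (f ω))) P :=
    (Real.measurable_exp.comp_aemeasurable hf).ennreal_ofReal
  have h1 := meas_ge_le_lintegral_div hm (ε := ENNReal.ofReal (Real.exp y))
    (by simp [Real.exp_pos]) ENNReal.ofReal_ne_top
  have h2 : {ω | y ≤ f ω} ⊆
      {ω | ENNReal.ofReal (Real.exp y) ≤ ENNReal.ofReal (Real.exp (f ω))} := fun ω hω =>
    ENNReal.ofReal_le_ofReal (Real.exp_le_exp.2 hω)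
  refine (measure_mono h2).trans (h1.trans ?_)
  rw [Real.exp_sub, ENNReal.ofReal_div_of_pos (Real.exp_pos y)]
  gcongr

theorem IsNormalComparison.measure_noise_ge_le [IsProbabilityMeasure P]
    (h : IsNormalComparison P σ p u N X)
    (i : Fin n) {l : ℝ} (hl : 0 ≤ l) (y : ℝ) :
    P {ω | y ≤ |noise u (fun e => N e ω) (fun e t => X e t ω) i|} ≤
      2 * ENNReal.ofReal
        (Real.exp (T * p * (Real.exp (σ ^ 2 * l ^ 2 / 2) - 1) * n - l * y)) := by
  have hm : AEMeasurable (fun ω => noise u (fun e => N e ω) (fun e t => X e t ω) i) P :=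
    Measurable.comp_aemeasurable
      (g := fun z : (Pair n → ℕ) × (Pair n × Fin T → ℝ) =>
        noise u z.1 (fun e t => z.2 (e, t)) i)
      (f := fun ω => ((fun e => N e ω), fun et : Pair n × Fin T => X et.1 et.2 ω))
      (measurable_noise u i) h.hasLaw_prod.aemeasurable
  have h1 := measure_le_of_lintegral_exp_le (hm.const_mul l) (h.lintegral_exp_noise_le i l) (l * y)
  have h2 := measure_le_of_lintegral_exp_le (hm.const_mul (-l))
    (h.lintegral_exp_noise_le i (-l)) (l * y)
  rw [neg_sq] at h2
  rw [two_mul]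
  refine (measure_mono fun ω hω => ?_).trans
    ((measure_union_le _ _).trans (add_le_add h1 h2))
  rcases le_abs.1 (Set.mem_ofPred_eq ▸ hω) with h' | h'
  · exact Or.inl (mul_le_mul_of_nonneg_left h' hl)
  · right
    have := mul_le_mul_of_nonneg_left h' hl
    rw [Set.mem_ofPred_eq]
    linarith

/-- Lower-tail Chernoff bound with exponential parameter `-1`, whence the factor `1 - exp (-1)`. -/
theorem IsNormalComparison.measure_sum_count_le (h : IsNormalComparison P σ p u N X)
    (S : Finset (Pair n)) (y : ℝ) :
    P {ω | ∑ e ∈ S, (N e ω : ℝ) ≤ y} ≤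
      ENNReal.ofReal (Real.exp (y - S.card * (T * p * (1 - Real.exp (-1))))) := by
  have hint : ∫⁻ ω, ENNReal.ofReal (Real.exp (-∑ e ∈ S, (N e ω : ℝ))) ∂P ≤
      ENNReal.ofReal (Real.exp (-(S.card * (T * p * (1 - Real.exp (-1)))))) := by
    have hm : Measurable fun k : Pair n → ℕ =>
        ENNReal.ofReal (Real.exp (-∑ e ∈ S, (k e : ℝ))) := .of_discrete
    rw [h.hasLaw_count.lintegral_comp hm.aemeasurable]
    have h1 : ∀ k : Pair n → ℕ, -∑ e ∈ S, (k e : ℝ) =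
        ∑ e, (if e ∈ S then -1 else 0) * (k e : ℝ) := by
      intro k
      simp [ite_mul, Finset.sum_ite_mem]
    simp_rw [h1]
    refine (lintegral_exp_pi_binomial_le p _).trans (ENNReal.ofReal_le_ofReal
      (Real.exp_le_exp.2 (le_of_eq ?_)))
    have h2 : ∀ e : Pair n, T * (p : ℝ) * (Real.exp (if e ∈ S then -1 else 0) - 1) =
        if e ∈ S then T * (p : ℝ) * (Real.exp (-1) - 1) else 0 := by
      intro e
      split_ifs <;> simp
    simp_rw [h2]
    rw [Finset.sum_ite_mem, Finset.univ_inter, Finset.sum_const, nsmul_eq_mul]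
    ring
  have hN : ∀ e, AEMeasurable (fun ω => (N e ω : ℝ)) P := fun e =>
    (Measurable.of_discrete (f := fun k : ℕ => (k : ℝ))).comp_aemeasurable
      (h.count_law e).aemeasurable
  have := measure_le_of_lintegral_exp_le
    (Finset.aemeasurable_fun_sum S fun e _ => hN e).neg hint (-y)
  simp only [Pi.neg_apply, neg_le_neg_iff] at this
  refine this.trans (le_of_eq ?_)
  ring_nf

end Model

/-! ### Union bounds for expansion and noise, and the nonasymptotic error bound. -/

theorem card_mul_card_compl_le_card_boundaryPairs {n : ℕ} {A B : Finset (Fin n)} (hAB : A ⊆ B) :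
    A.card * (n - B.card) ≤ (boundaryPairs A B).card := by
  have h : (A ×ˢ Bᶜ).card ≤ (boundaryPairs A B).card := by
    refine Finset.card_le_card_of_surjOn
      (fun e => if e.1.1 ∈ A then (e.1.1, e.1.2) else (e.1.2, e.1.1)) ?_
    rintro ⟨i, j⟩ hij
    simp only [Finset.coe_product, Set.mem_prod, Finset.mem_coe, Finset.mem_compl] at hij
    have hj : j ∉ A := fun h => hij.2 (hAB h)
    have hne : i ≠ j := fun h => hj (h ▸ hij.1)
    rcases lt_or_gt_of_ne hne with hlt | hlt
    · exact ⟨⟨(i, j), hlt⟩, by simp [boundaryPairs, hij.1, hij.2], by simp [hij.1]⟩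
    · exact ⟨⟨(j, i), hlt⟩, by simp [boundaryPairs, hij.1, hij.2], by simp [hj]⟩
  rwa [Finset.card_product, Finset.card_compl, Fintype.card_fin] at h

/-- Total weight in the union bound over pairs of sets: each factor is `(1 + 1/n) ^ n ≤ e ≤ 3`. -/
theorem sum_pow_card_mul_pow_card_le {n : ℕ} (hn : 0 < n) :
    ∑ AB : Finset (Fin n) × Finset (Fin n),
      (1 / (n : ℝ)) ^ AB.1.card * (1 / (n : ℝ)) ^ AB.2.card ≤ 9 := by
  have hn' : (0 : ℝ) < n := by exact_mod_cast hn
  have h1 : ∑ A : Finset (Fin n), (1 / (n : ℝ)) ^ A.card ≤ 3 := by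
    have := Fintype.sum_pow_mul_eq_add_pow (Fin n) (1 / (n : ℝ)) 1
    simp only [one_pow, mul_one, Fintype.card_fin] at this
    rw [this]
    calc (1 / (n : ℝ) + 1) ^ n ≤ Real.exp (1 / n) ^ n :=
          pow_le_pow_left₀ (by positivity) (Real.add_one_le_exp _) n
      _ = Real.exp 1 := by rw [← Real.exp_nat_mul]; congr 1; field_simp
      _ ≤ 3 := by linarith [Real.exp_one_lt_d9]
  have h0 : 0 ≤ ∑ A : Finset (Fin n), (1 / (n : ℝ)) ^ A.card :=
    Finset.sum_nonneg fun _ _ => by positivity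
  rw [Fintype.sum_prod_type]
  simp_rw [← Finset.mul_sum]
  rw [← Finset.sum_mul]
  nlinarith

section Model

variable {Ω : Type*} [MeasurableSpace Ω] {P : Measure Ω} {σ : ℝ}
  {n T : ℕ} {p : unitInterval} {u : Fin n → ℝ} {N : Pair n → Ω → ℕ} {X : Pair n → Fin T → Ω → ℝ}

/-- With at least `#A * n / 2` boundary pairs and `1 - exp (-1) > 0.632`, the Chernoff exponent is
at most `(1/20 - 0.316) * #A * np`. The target costs `(3 + #A + #B) * log n ≤ #A * np / 4`: one
eighth pays for `#B` by the size condition, the other for `3 + #A ≤ 4 * #A` by `hnp`. -/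
theorem IsNormalComparison.measure_boundary_count_le (h : IsNormalComparison P σ p u N X)
    (hT : 1 ≤ T) (hn : 2 ≤ n) (hnp : 32 * Real.log n ≤ n * p) {A B : Finset (Fin n)}
    (hA : A.Nonempty) (hAB : A ⊆ B) (hB : 2 * B.card ≤ n)
    (hBA : (B.card : ℝ) ≤ n * p / (8 * Real.log n) * A.card) :
    P {ω | ∑ e ∈ boundaryPairs A B, (N e ω : ℝ) ≤ n * p / 20 * A.card} ≤
      ENNReal.ofReal ((1 / (n : ℝ)) ^ 3 *
        ((1 / (n : ℝ)) ^ A.card * (1 / (n : ℝ)) ^ B.card)) := by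
  have hn0 : (0 : ℝ) < n := by positivity
  have hL : 0 < Real.log n := Real.log_pos (by exact_mod_cast hn)
  have hinv : 1 / (n : ℝ) = Real.exp (-Real.log n) := by
    rw [Real.exp_neg, Real.exp_log hn0, one_div]
  refine (h.measure_sum_count_le _ _).trans (ENNReal.ofReal_le_ofReal ?_)
  rw [hinv, ← Real.exp_nat_mul, ← Real.exp_nat_mul, ← Real.exp_nat_mul, ← Real.exp_add,
    ← Real.exp_add, Real.exp_le_exp]
  have ha : (1 : ℝ) ≤ A.card := by exact_mod_cast hA.card_pos
  have hS : (A.card : ℝ) * (n / 2) ≤ (boundaryPairs A B).card := by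
    have h1 := card_mul_card_compl_le_card_boundaryPairs hAB
    have h2 : ((A.card * (n - B.card) : ℕ) : ℝ) ≤ (boundaryPairs A B).card := Nat.cast_le.2 h1
    have h3 : 2 * (B.card : ℝ) ≤ n := by exact_mod_cast hB
    rw [Nat.cast_mul, Nat.cast_sub (by omega)] at h2
    refine le_trans ?_ h2
    exact mul_le_mul_of_nonneg_left (by linarith) (by linarith)
  have hp0 : (0 : ℝ) ≤ p := p.2.1
  have hT' : (1 : ℝ) ≤ T := by exact_mod_cast hT
  have he := Real.exp_neg_one_lt_d9
  have hrate : (p : ℝ) * 0.632 ≤ T * p * (1 - Real.exp (-1)) := by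
    have h1 : (p : ℝ) ≤ T * p := le_mul_of_one_le_left hp0 hT'
    exact mul_le_mul h1 (by linarith) (by norm_num) (by positivity)
  have hprod : (A.card : ℝ) * (n / 2) * (p * 0.632) ≤
      (boundaryPairs A B).card * (T * p * (1 - Real.exp (-1))) :=
    mul_le_mul hS hrate (by positivity) (by positivity)
  have hb : (B.card : ℝ) * Real.log n ≤ A.card * (n * p) / 8 := by
    have := mul_le_mul_of_nonneg_right hBA hL.le
    refine this.trans (le_of_eq ?_)
    field_simp
  have hanp : (A.card : ℝ) * (32 * Real.log n) ≤ A.card * (n * p) :=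
    mul_le_mul_of_nonneg_left hnp (by linarith)
  have haL : Real.log n ≤ A.card * Real.log n := le_mul_of_one_le_left hL.le ha
  have h0 : 0 ≤ (A.card : ℝ) * (n * p) := by positivity
  push_cast
  linarith

theorem IsNormalComparison.measure_not_expands_le (h : IsNormalComparison P σ p u N X)
    (hT : 1 ≤ T) (hn : 2 ≤ n) (hnp : 32 * Real.log n ≤ n * p) :
    P {ω | ¬ Expands (fun e => ((observed T (fun e => N e ω) e).card : ℝ)) (n * p / 20)
      (n * p / (8 * Real.log n))} ≤ ENNReal.ofReal (9 / (n : ℝ) ^ 3) := by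
  classical
  set good : Finset (Finset (Fin n) × Finset (Fin n)) := Finset.univ.filter fun AB =>
    AB.1.Nonempty ∧ AB.1 ⊆ AB.2 ∧ 2 * AB.2.card ≤ n ∧
      (AB.2.card : ℝ) ≤ n * p / (8 * Real.log n) * AB.1.card with hgood
  -- Almost surely no count exceeds `T`, so the number of observed outcomes is the count itself.
  have hN : ∀ᵐ ω ∂P, ∀ e, N e ω ≤ T :=
    ae_all_iff.2 fun e => ae_le_of_hasLaw_binomial (h.count_law e)
  have hsub : {ω | ¬ Expands (fun e => ((observed T (fun e => N e ω) e).card : ℝ)) (n * p / 20)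
      (n * p / (8 * Real.log n))} ≤ᵐ[P]
      (⋃ AB ∈ good, {ω | ∑ e ∈ boundaryPairs AB.1 AB.2, (N e ω : ℝ) ≤ n * p / 20 * AB.1.card} :
        Set Ω) := by
    filter_upwards [hN] with ω hω hbad
    have hbad' : ¬ Expands (fun e => ((observed T (fun e => N e ω) e).card : ℝ)) (n * p / 20)
      (n * p / (8 * Real.log n)) := hbad
    simp only [Expands] at hbad'
    push Not at hbad'
    obtain ⟨A, B, hA, hAB, hB, hBA, hlt⟩ := hbad'
    have hc : ∀ e : Pair n, (observed T (fun e => N e ω) e).card = N e ω := fun e =>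
      card_observed (hω e)
    simp_rw [hc] at hlt
    refine Set.mem_biUnion (x := (A, B)) ?_ hlt.le
    simp only [hgood, Finset.coe_filter, Finset.mem_univ, true_and]
    exact ⟨hA, hAB, hB, hBA⟩
  have hn0 : (0 : ℝ) < n := by positivity
  refine (measure_mono_ae hsub).trans ((measure_biUnion_finset_le _ _).trans ?_)
  refine (Finset.sum_le_sum (g := fun AB => ENNReal.ofReal ((1 / (n : ℝ)) ^ 3 *
        ((1 / (n : ℝ)) ^ AB.1.card * (1 / (n : ℝ)) ^ AB.2.card))) fun AB hmem => ?_).trans ?_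
  · simp only [hgood, Finset.mem_filter, Finset.mem_univ, true_and] at hmem
    exact h.measure_boundary_count_le hT hn hnp hmem.1 hmem.2.1 hmem.2.2.1 hmem.2.2.2
  rw [← ENNReal.ofReal_sum_of_nonneg fun _ _ => by positivity]
  refine ENNReal.ofReal_le_ofReal ?_
  refine (Finset.sum_le_sum_of_subset_of_nonneg (Finset.subset_univ _)
    fun _ _ _ => by positivity).trans ?_
  rw [← Finset.mul_sum]
  refine (mul_le_mul_of_nonneg_left (sum_pow_card_mul_pow_card_le (by omega))
    (by positivity)).trans (le_of_eq ?_)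
  field_simp

theorem IsNormalComparison.measure_exists_noise_ge_le [IsProbabilityMeasure P]
    (h : IsNormalComparison P σ p u N X) (hn : 2 ≤ n) (hp : 0 < n * (p : ℝ))
    (hσp : σ ^ 2 * Real.log n ≤ 2 * (n * p)) :
    P {ω | ∃ i, (T * σ ^ 2 + 4) * √(n * p * Real.log n) ≤
        |noise u (fun e => N e ω) (fun e t => X e t ω) i|} ≤
      ENNReal.ofReal (2 / (n : ℝ) ^ 3) := by
  have hn0 : (0 : ℝ) < n := by positivity
  have hL : 0 < Real.log n := Real.log_pos (by exact_mod_cast hn)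
  have hp0 : 0 < (p : ℝ) := pos_of_mul_pos_right hp hn0.le
  -- With this Chernoff parameter the moment term is at most `T * σ ^ 2 * log n` and the threshold
  -- term is `(T * σ ^ 2 + 4) * log n`. The remaining `n ^ (-4)` loses one power to the union over
  -- subjects.
  set l := √(Real.log n / (n * p)) with hl
  have hl2 : l ^ 2 = Real.log n / (n * p) := Real.sq_sqrt (by positivity)
  have hs1 : σ ^ 2 * l ^ 2 / 2 ≤ 1 := by
    rw [hl2, ← mul_div_assoc, div_div, div_le_one (by positivity)]
    linarith
  have hexp : Real.exp (σ ^ 2 * l ^ 2 / 2) - 1 ≤ σ ^ 2 * l ^ 2 := by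
    have h0 : 0 ≤ σ ^ 2 * l ^ 2 / 2 := by positivity
    have := Real.abs_exp_sub_one_le (x := σ ^ 2 * l ^ 2 / 2) (by rwa [abs_of_nonneg h0])
    rw [abs_of_nonneg h0] at this
    linarith [le_abs_self (Real.exp (σ ^ 2 * l ^ 2 / 2) - 1)]
  have hly : l * √(n * p * Real.log n) = Real.log n := by
    rw [hl, ← Real.sqrt_mul (by positivity)]
    have : Real.log n / (n * p) * (n * p * Real.log n) = Real.log n ^ 2 := by field_simp
    rw [this, Real.sqrt_sq hL.le]
  have hone : ∀ i, P {ω | (T * σ ^ 2 + 4) * √(n * p * Real.log n) ≤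
      |noise u (fun e => N e ω) (fun e t => X e t ω) i|} ≤
      ENNReal.ofReal (2 / (n : ℝ) ^ 4) := by
    intro i
    refine (h.measure_noise_ge_le i (l := l) (Real.sqrt_nonneg _) _).trans ?_
    have h2 : (2 : ℝ≥0∞) = ENNReal.ofReal 2 := by simp
    rw [h2, ← ENNReal.ofReal_mul zero_le_two]
    refine ENNReal.ofReal_le_ofReal ?_
    rw [div_eq_mul_inv 2 ((n : ℝ) ^ 4)]
    refine mul_le_mul_of_nonneg_left ?_ zero_le_two
    have h3 : ((n : ℝ) ^ 4)⁻¹ = Real.exp (-(4 * Real.log n)) := by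
      rw [Real.exp_neg, show (4 : ℝ) * Real.log n = (4 : ℕ) * Real.log n by norm_num,
        Real.exp_nat_mul, Real.exp_log hn0]
    rw [h3, Real.exp_le_exp]
    have h4 : T * (p : ℝ) * (Real.exp (σ ^ 2 * l ^ 2 / 2) - 1) * n ≤
        T * σ ^ 2 * Real.log n := by
      calc T * (p : ℝ) * (Real.exp (σ ^ 2 * l ^ 2 / 2) - 1) * n
          ≤ T * (p : ℝ) * (σ ^ 2 * l ^ 2) * n := by gcongr
        _ = T * σ ^ 2 * ((n * p) * l ^ 2) := by ring
        _ = T * σ ^ 2 * Real.log n := by rw [hl2, mul_div_cancel₀ _ hp.ne']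
    have h5 : l * ((T * σ ^ 2 + 4) * √(n * p * Real.log n)) =
        (T * σ ^ 2 + 4) * Real.log n := by
      rw [mul_left_comm, hly]
    rw [h5]
    linarith
  have hset : {ω | ∃ i, (T * σ ^ 2 + 4) * √(n * p * Real.log n) ≤
        |noise u (fun e => N e ω) (fun e t => X e t ω) i|} =
      ⋃ i ∈ (Finset.univ : Finset (Fin n)), {ω | (T * σ ^ 2 + 4) * √(n * p * Real.log n) ≤
        |noise u (fun e => N e ω) (fun e t => X e t ω) i|} := by
    ext ω; simp
  rw [hset]
  refine (measure_biUnion_finset_le _ _).trans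
    ((Finset.sum_le_sum fun i _ => hone i).trans (le_of_eq ?_))
  rw [Finset.sum_const, Finset.card_univ, Fintype.card_fin, nsmul_eq_mul,
    ← ENNReal.ofReal_natCast, ← ENNReal.ofReal_mul hn0.le]
  congr 1
  field_simp

/-- Nonasymptotic form of the error bound for the least squares estimate. -/
theorem IsNormalComparison.measure_not_mle_near_le [IsProbabilityMeasure P]
    (h : IsNormalComparison P σ p u N X) (hσ : 0 < σ) (hu : u ∈ scoreSpace n)
    (hT : 1 ≤ T) (hn : 2 ≤ n) (hnp : 32 * Real.log n ≤ n * p)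
    (hσp : σ ^ 2 * Real.log n ≤ 2 * (n * p)) (hlog : 0 < Real.log (n * p))
    (hρ : Real.log (n * p) / 4 ≤ Real.log (n * p / (8 * Real.log n))) :
    P {ω | ¬ ((∃! v, IsMLE (normalLink σ) (fun e => N e ω) (fun e t => X e t ω) v) ∧
      ∀ v, IsMLE (normalLink σ) (fun e => N e ω) (fun e t => X e t ω) v →
        ‖v - u‖ ≤ 400 * (T * σ ^ 2 + 4) * rate n p)} ≤ ENNReal.ofReal (14 / (n : ℝ) ^ 2) := by
  have hn0 : (0 : ℝ) < n := by positivity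
  have hL : 0 < Real.log n := Real.log_pos (by exact_mod_cast hn)
  have hp : 0 < n * (p : ℝ) := by linarith
  set ρ := n * (p : ℝ) / (8 * Real.log n) with hρdef
  set K := ⌈Real.log n / Real.log ρ⌉₊ with hKdef
  set κ := T * σ ^ 2 + 4 with hκ
  set R := Real.log n / Real.log (n * p) with hR
  have hκ0 : 0 < κ := by positivity
  have hρ0 : 0 < ρ := by positivity
  have hlogρ : 0 < Real.log ρ := by linarith
  have hK : (n : ℝ) ≤ ρ ^ K := by
    rw [← Real.log_le_log_iff hn0 (by positivity), Real.log_pow, ← div_le_iff₀ hlogρ]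
    exact Nat.le_ceil _
  have hR1 : 1 ≤ R := by
    rw [hR, one_le_div hlog]
    refine Real.log_le_log hp ?_
    have : (p : ℝ) ≤ 1 := p.2.2
    nlinarith
  -- Four from the lower bound on `log ρ`, one from the ceiling, as `1 ≤ R` because `np ≤ n`.
  have hKR : (K : ℝ) ≤ 5 * R := by
    have h1 : (K : ℝ) < Real.log n / Real.log ρ + 1 := Nat.ceil_lt_add_one (by positivity)
    have h2 : Real.log n / Real.log ρ ≤ Real.log n / (Real.log (n * p) / 4) :=
      div_le_div_of_nonneg_left hL.le (by positivity) hρ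
    have h3 : Real.log n / (Real.log (n * p) / 4) = 4 * R := by rw [hR]; field_simp
    linarith
  set β := κ * √(n * p * Real.log n) with hβdef
  -- The step height, chosen so that `d * γ = 2 * β` with `γ = np / 20`.
  set d := 40 * κ * √(Real.log n / (n * p)) with hd
  have hsq : √(Real.log n / (n * p)) * (n * p) = √(n * p * Real.log n) := by
    rw [← Real.sqrt_sq hp.le, ← Real.sqrt_mul (by positivity), Real.sqrt_sq hp.le]
    congr 1
    field_simp
  have hβ : β < d * (n * p / 20) := by
    have h1 : d * (n * p / 20) = 2 * β := by
      rw [hd, hβdef, ← hsq]; ring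
    have h2 : 0 < β := by positivity
    linarith
  have hKd : 2 * K * d ≤ 400 * κ * rate n p := by
    have h1 : 400 * κ * rate n p = 2 * (5 * R) * d := by
      rw [rate, hd, hR]; ring
    rw [h1]
    have : 0 ≤ d := by positivity
    gcongr
  have hsub : {ω | ¬ ((∃! v, IsMLE (normalLink σ) (fun e => N e ω) (fun e t => X e t ω) v) ∧
      ∀ v, IsMLE (normalLink σ) (fun e => N e ω) (fun e t => X e t ω) v →
        ‖v - u‖ ≤ 400 * κ * rate n p)} ⊆
      {ω | ¬ Expands (fun e => ((observed T (fun e => N e ω) e).card : ℝ)) (n * p / 20) ρ} ∪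
      {ω | ∃ i, β ≤ |noise u (fun e => N e ω) (fun e t => X e t ω) i|} := by
    intro ω hω
    by_contra hcon
    rw [Set.mem_union, not_or] at hcon
    obtain ⟨hE, hB⟩ := hcon
    have hE' := not_not.1 hE
    have hB' : ∀ i, |noise u (fun e => N e ω) (fun e t => X e t ω) i| ≤ β := fun i =>
      le_of_lt (not_le.1 fun hi => hB ⟨i, hi⟩)
    exact hω ⟨existsUnique_isMLE hσ (by positivity) hE' hρ0.le hK, fun v hv =>
      (hv.norm_sub_le hσ hE' hρ0.le hu hB' hβ (by positivity) hK).trans hKd⟩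
  refine (measure_mono hsub).trans ((measure_union_le _ _).trans
    ((add_le_add (h.measure_not_expands_le hT hn hnp)
      (h.measure_exists_noise_ge_le hn hp hσp)).trans ?_))
  rw [← ENNReal.ofReal_add (by positivity) (by positivity)]
  refine ENNReal.ofReal_le_ofReal ?_
  rw [← add_div, div_le_div_iff₀ (by positivity) (by positivity)]
  have h1 : (1 : ℝ) ≤ n := by exact_mod_cast (by omega : 1 ≤ n)
  have h2 : (n : ℝ) ^ 2 * 1 ≤ n ^ 2 * n := mul_le_mul_of_nonneg_left h1 (by positivity)
  nlinarith

end Model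

/-! ### Asymptotics and Borel–Cantelli. -/

theorem tendsto_mul_atTop_of_le {p : ℕ → unitInterval}
    (hp : ∃ c : ℝ, 1 < c ∧ ∀ᶠ n : ℕ in atTop, c * (Real.log n / n) ≤ (p n : ℝ)) :
    Tendsto (fun n : ℕ => (n : ℝ) * (p n : ℝ)) atTop atTop := by
  obtain ⟨c, hc, h⟩ := hp
  refine tendsto_atTop_mono' _ ?_ (Real.tendsto_log_atTop.comp tendsto_natCast_atTop_atTop)
  filter_upwards [h, eventually_ge_atTop 1] with n hn h1
  have hn0 : (0 : ℝ) < n := by exact_mod_cast h1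
  have hL : 0 ≤ Real.log n := Real.log_nonneg (by exact_mod_cast h1)
  have h2 := mul_le_mul_of_nonneg_left hn hn0.le
  have h3 : (n : ℝ) * (c * (Real.log n / n)) = c * Real.log n := by field_simp
  rw [Function.comp_apply]
  nlinarith

/-- A vanishing rate forces `n p` to dominate `log n` polynomially. -/
theorem eventually_sparsity_of_tendsto_rate {p : ℕ → unitInterval}
    (hp : Tendsto (fun n : ℕ => (n : ℝ) * (p n : ℝ)) atTop atTop)
    (hrate : Tendsto (fun n : ℕ => rate n (p n)) atTop (𝓝 0)) {M : ℝ} (hM : 0 < M) :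
    ∀ᶠ n : ℕ in atTop, M * Real.log n ≤ n * (p n : ℝ) ∧ 0 < Real.log (n * (p n : ℝ)) ∧
      Real.log (n * (p n : ℝ)) / 4 ≤ Real.log (n * (p n : ℝ) / (8 * Real.log n)) := by
  have hz : Tendsto (fun n : ℕ => Real.log ((n : ℝ) * (p n : ℝ))) atTop atTop :=
    Real.tendsto_log_atTop.comp hp
  have hloglog : ∀ᶠ z : ℝ in atTop, Real.log z ≤ z / 4 := by
    have := Real.isLittleO_log_id_atTop.bound (show (0 : ℝ) < 1 / 4 by norm_num)
    filter_upwards [this, eventually_ge_atTop 1] with z hz h1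
    rw [Real.norm_eq_abs, Real.norm_eq_abs, id, abs_of_nonneg (Real.log_nonneg h1),
      abs_of_nonneg (by linarith)] at hz
    linarith
  -- The bound `√(1 / M)` yields `M * log n ≤ np`; the bound `1` is used after taking logarithms.
  have hsmall : ∀ᶠ n : ℕ in atTop, rate n (p n) < min 1 (√(1 / M)) :=
    hrate.eventually_lt_const (by positivity)
  filter_upwards [hsmall, hz.eventually hloglog, hz.eventually_ge_atTop (4 * Real.log 8),
    hz.eventually_gt_atTop 0, hp.eventually_gt_atTop 0, eventually_ge_atTop 2]
    with n hr hll h8 hlog hy hn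
  have hn0 : (0 : ℝ) < n := by positivity
  have hL : 0 < Real.log n := Real.log_pos (by exact_mod_cast hn)
  set y := (n : ℝ) * (p n : ℝ) with hydef
  have hR1 : 1 ≤ Real.log n / Real.log y := by
    rw [one_le_div hlog]
    refine Real.log_le_log hy ?_
    have : (p n : ℝ) ≤ 1 := (p n).2.2
    nlinarith
  rw [rate, ← hydef, lt_min_iff] at hr
  have hs : √(Real.log n / y) ≤ √(Real.log n / y) * (Real.log n / Real.log y) :=
    le_mul_of_one_le_right (Real.sqrt_nonneg _) hR1
  refine ⟨?_, hlog, ?_⟩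
  · have h1 := (Real.sqrt_lt_sqrt_iff (by positivity)).1 (hs.trans_lt hr.2)
    rw [div_lt_div_iff₀ hy hM] at h1
    linarith
  -- Negativity of `log rate` reads `(3/2) log log n < (1/2) log y + log log y`. With `log log y ≤
  -- (log y) / 4` this gives `log log n < (log y) / 2`, and `log 8 ≤ (log y) / 4` leaves a quarter
  -- of `log y`.
  · have h2 := Real.log_neg (by positivity) hr.1
    rw [Real.log_mul (by positivity) (by positivity), Real.log_sqrt (by positivity),
      Real.log_div hL.ne' hy.ne', Real.log_div hL.ne' hlog.ne'] at h2
    rw [Real.log_div hy.ne' (by positivity), Real.log_mul (by norm_num) hL.ne']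
    linarith

theorem mainTheorem7 (σ : ℝ) (hσ : 0 < σ) (T : ℕ) (hT : 1 ≤ T) :
    ∃ C : ℝ, 0 < C ∧
      ∀ (Ω : Type*) [MeasurableSpace Ω] (P : Measure Ω) [IsProbabilityMeasure P]
        (p : ℕ → unitInterval) (u : (n : ℕ) → Fin n → ℝ)
        (N : (n : ℕ) → Pair n → Ω → ℕ) (X : (n : ℕ) → Pair n → Fin T → Ω → ℝ),
        (∀ n, u n ∈ scoreSpace n) →
        (∀ n, IsNormalComparison P σ (p n) (u n) (N n) (X n)) →
        -- standing sparsity assumption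
        (∃ c : ℝ, 1 < c ∧ ∀ᶠ n : ℕ in atTop, c * (Real.log n / n) ≤ (p n : ℝ)) →
        Tendsto (fun n : ℕ => dynamicRange (u n) * Real.exp (dynamicRange (u n)) *
          (Real.log n / Real.log (n * (p n : ℝ)))) atTop (𝓝 0) →
        Tendsto (fun n : ℕ => rate n (p n)) atTop (𝓝 0) →
        -- outside an event of (outer) probability at most `14 / n ^ 2`, the estimate exists,
        -- is unique, and is within `C * rate` of the true scores in the sup norm
        (∀ᶠ n : ℕ in atTop,
          P {ω | ¬ ((∃! v, IsMLE (normalLink σ) (fun e => N n e ω) (fun e t => X n e t ω) v) ∧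
              ∀ v, IsMLE (normalLink σ) (fun e => N n e ω) (fun e t => X n e t ω) v →
                ‖v - u n‖ ≤ C * rate n (p n))}
            ≤ ENNReal.ofReal (14 / (n : ℝ) ^ 2)) ∧
        -- almost surely, the estimate exists and is unique for all but finitely many `n`,
        -- and it converges uniformly to the true scores
        (∀ᵐ ω ∂P,
          (∀ᶠ n : ℕ in atTop,
            ∃! v, IsMLE (normalLink σ) (fun e => N n e ω) (fun e t => X n e t ω) v) ∧
          ∀ w : (n : ℕ) → Fin n → ℝ,
            (∀ᶠ n : ℕ in atTop,
              IsMLE (normalLink σ) (fun e => N n e ω) (fun e t => X n e t ω) (w n)) →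
            Tendsto (fun n => ‖w n - u n‖) atTop (𝓝 0)) := by
  refine ⟨400 * (T * σ ^ 2 + 4), by positivity, ?_⟩
  intro Ω _ P _ p u N X hu hmodel hp _ hrate
  have hev : ∀ᶠ n : ℕ in atTop,
      P {ω | ¬ ((∃! v, IsMLE (normalLink σ) (fun e => N n e ω) (fun e t => X n e t ω) v) ∧
          ∀ v, IsMLE (normalLink σ) (fun e => N n e ω) (fun e t => X n e t ω) v →
            ‖v - u n‖ ≤ 400 * (T * σ ^ 2 + 4) * rate n (p n))}
        ≤ ENNReal.ofReal (14 / (n : ℝ) ^ 2) := by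
    filter_upwards [eventually_sparsity_of_tendsto_rate (tendsto_mul_atTop_of_le hp) hrate
      (show 0 < 32 + σ ^ 2 by positivity), eventually_ge_atTop 2] with n ⟨h1, h2, h3⟩ hn
    have hL : 0 < Real.log n := Real.log_pos (by exact_mod_cast hn)
    have hσL : 0 ≤ σ ^ 2 * Real.log n := by positivity
    exact (hmodel n).measure_not_mle_near_le hσ (hu n) hT hn (by linarith) (by linarith) h2 h3
  refine ⟨hev, ?_⟩
  obtain ⟨n₀, hn₀⟩ := eventually_atTop.1 hev
  -- The bad events are replaced by `∅` below `n₀`, so that the bound `14 / n ^ 2` holds for every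
  -- term and Borel–Cantelli applies.
  have hsum : (∑' n, P (if n₀ ≤ n then
      {ω | ¬ ((∃! v, IsMLE (normalLink σ) (fun e => N n e ω) (fun e t => X n e t ω) v) ∧
          ∀ v, IsMLE (normalLink σ) (fun e => N n e ω) (fun e t => X n e t ω) v →
            ‖v - u n‖ ≤ 400 * (T * σ ^ 2 + 4) * rate n (p n))} else ∅)) ≠ ∞ := by
    have hsummable : Summable fun n : ℕ => 14 / (n : ℝ) ^ 2 := by
      simpa [div_eq_mul_inv] using
        (Real.summable_nat_pow_inv.2 (by norm_num : 1 < 2)).mul_left (14 : ℝ)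
    refine ne_top_of_le_ne_top hsummable.tsum_ofReal_ne_top (ENNReal.tsum_le_tsum fun n => ?_)
    split_ifs with h
    · exact hn₀ n h
    · simp
  filter_upwards [ae_eventually_notMem hsum] with ω hω
  have hgood : ∀ᶠ n : ℕ in atTop,
      (∃! v, IsMLE (normalLink σ) (fun e => N n e ω) (fun e t => X n e t ω) v) ∧
          ∀ v, IsMLE (normalLink σ) (fun e => N n e ω) (fun e t => X n e t ω) v →
            ‖v - u n‖ ≤ 400 * (T * σ ^ 2 + 4) * rate n (p n) := by
    filter_upwards [hω, eventually_ge_atTop n₀] with n h1 h2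
    rw [if_pos h2] at h1
    exact not_not.1 h1
  refine ⟨hgood.mono fun n h => h.1, fun w hw => ?_⟩
  have hlim : Tendsto (fun n : ℕ => 400 * (T * σ ^ 2 + 4) * rate n (p n)) atTop (𝓝 0) := by
    simpa using hrate.const_mul (400 * (T * σ ^ 2 + 4))
  exact squeeze_zero' (Eventually.of_forall fun n => norm_nonneg _)
    ((hgood.and hw).mono fun n h => h.1.2 _ h.2) hlim
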